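/- Let $0<d<\pi/2$, let $\mathscr{D}_d=\{\zeta\in\mathbb{C}:|\operatorname{Im}\zeta|<d\}$, $\mathscr{D}_d^{-}=\{\zeta\in\mathscr{D}_d:\operatorname{Re}\zeta<0\}$, $\mathscr{D}_d^{+}=\{\zeta\in\mathscr{D}_d:\operatorname{Re}\zeta\ge 0\}$, and let $\psi(\zeta)=\sinh\left(\frac{\pi}{2}\sinh\zeta\right)$. For $\gamma>0$ put \[ x_\gamma=\begin{cases}\operatorname{arcsinh}\left(\dfrac{\sqrt{1+\sqrt{1-(2\pi\gamma)^2}}}{2\pi\gamma}\right) & (0<\gamma<1/(2\pi)),\\[2mm] \operatorname{arcsinh}(1) & (1/(2\pi)\le\gamma).\end{cases} \] Assume that $f$ is analytic in $\psi(\mathscr{D}_d)$ and that there are positive constants $K,\alpha,\beta$ such that \[ |f(z)|\le \frac{K}{|1+z^2|^{(\alpha+1)/2}}\quad\text{for all } z\in\psi(\mathscr{D}_d^{-}),\qquad |f(z)|\le \frac{K}{|1+z^2|^{(\beta+1)/2}}\quad\text{for all } z\in\psi(\mathscr{D}_d^{+}). \] Let $\mu=\min\{\alpha,\beta\}$ and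 $\nu=\max\{\alpha,\beta\}$. For a natural number $n$ let $h=\log(8dn/\mu)/n$, and let \[ \begin{cases} M=n,\quad N=n-\lfloor\log(\beta/\alpha)/h\rfloor & (\text{if }\mu=\alpha),\\ N=n,\quad M=n-\lfloor\log(\alpha/\beta)/h\rfloor & (\text{if }\mu=\beta).\end{cases} \] Suppose that $n$ is so large that $n\ge \nu\mathrm{e}/(8d)$, $Mh\ge x_{\alpha/2}$ and $Nh\ge x_{\beta/2}$. Then $f$ is integrable on $\mathbb{R}$ and \[ \left|\int_{-\infty}^{\infty} f(t)\,\mathrm{d}t-h\sum_{k=-M}^{N} f(\psi(kh))\,\psi'(kh)\right|\le C_1\,\mathrm{e}^{-2\pi dn/\log(8dn/\mu)}, \] where $C_1$ is the constant, independent of $n$, \[ C_1=\frac{2^{\nu+1}K}{\mu}\left\{\frac{2}{(1-\mathrm{e}^{-\pi\mu\mathrm{e}/4})\{\cos(\frac{\pi}{2}\sin d)\}^{\nu}\cos d}+\mathrm{e}^{\pi\nu/4}\right\}. \] -/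

import Mathlib

noncomputable section

namespace SincQuad

/-- The strip `{ζ : |Im ζ| < d}`. -/
def strip (d : ℝ) : Set ℂ := {ζ | |ζ.im| < d}

/-- The left part `{ζ : |Im ζ| < d, Re ζ < 0}` of the strip. -/
def stripNeg (d : ℝ) : Set ℂ := {ζ | ζ ∈ strip d ∧ ζ.re < 0}

/-- The right part `{ζ : |Im ζ| < d, 0 ≤ Re ζ}` of the strip. -/
def stripPos (d : ℝ) : Set ℂ := {ζ | ζ ∈ strip d ∧ 0 ≤ ζ.re}

/-- The double-exponential map `ζ ↦ sinh ((π / 2) sinh ζ)` on the complex plane. -/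
def deMap (ζ : ℂ) : ℂ := Complex.sinh ((Real.pi / 2 : ℂ) * Complex.sinh ζ)

/-- The comparison function `1 / (1 + z ^ 2) ^ ((γ + 1) / 2)`. Only its modulus is used, so the
choice of the branch of the power does not matter. -/
def E₁ (z : ℂ) (γ : ℝ) : ℂ := 1 / (1 + z ^ 2) ^ (((γ + 1) / 2 : ℝ) : ℂ)

/-- The threshold `x_γ`, for `γ > 0`. -/
def threshold (γ : ℝ) : ℝ :=
  if γ < 1 / (2 * Real.pi) then
    Real.arsinh (√(1 + √(1 - (2 * Real.pi * γ) ^ 2)) / (2 * Real.pi * γ))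
  else Real.arsinh 1

/-- The mesh size `h = log (8 d n / μ) / n`. -/
def stepSize (d μ : ℝ) (n : ℕ) : ℝ := Real.log (8 * d * n / μ) / n

/-- The left truncation limit `M`: it is `n` if `min α β = α`, and `n - ⌊log (α / β) / h⌋` if
`min α β = β` (both equal `n` if `α = β`). -/
def leftLimit (α β h : ℝ) (n : ℕ) : ℤ :=
  if min α β = α then (n : ℤ) else (n : ℤ) - ⌊Real.log (α / β) / h⌋

/-- The right truncation limit `N`: it is `n` if `min α β = β`, and `n - ⌊log (β / α) / h⌋` if
`min α β = α` (both equal `n` if `α = β`). -/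
def rightLimit (α β h : ℝ) (n : ℕ) : ℤ :=
  if min α β = β then (n : ℤ) else (n : ℤ) - ⌊Real.log (β / α) / h⌋

/-- The truncated sum `h ∑_{k = -M}^{N} f(ψ(kh)) ψ'(kh)` with `ψ = deMap`. -/
def deQuadrature (f : ℂ → ℂ) (h : ℝ) (M N : ℤ) : ℂ :=
  (h : ℂ) * ∑ k ∈ Finset.Icc (-M) N,
    f (deMap (((k : ℝ) * h : ℝ) : ℂ)) * deriv deMap (((k : ℝ) * h : ℝ) : ℂ)

/-- The explicit constant `C₁`, with `μ = min α β` and `ν = max α β`. -/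
def C₁ (K μ ν d : ℝ) : ℝ :=
  2 ^ (ν + 1) * K / μ *
    (2 / ((1 - Real.exp (-(Real.pi * μ * Real.exp 1 / 4)))
          * Real.cos (Real.pi / 2 * Real.sin d) ^ ν * Real.cos d)
      + Real.exp (Real.pi * ν / 4))

end SincQuad

end

noncomputable section

open Real Filter Topology MeasureTheory Asymptotics
open scoped FourierTransform

namespace SincQuad

/-! Write ψ for `deMap`, F = (f ∘ ψ)ψ' and L = log(8dn/μ), so that h = L/n. On the real line ∫ f = ∫
F, and the error splits into a discretization error (full trapezoidal sum of F) and a truncation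
error (the terms outside [-M, N]).

Both rest on `cosh_mul_cos_le_norm_cosh`. Since 1 + ψ² is the square of cosh((π/2) sinh ζ), and ψ'
contains the same cosh once, that lower bound gives |F(x + iy)| ≤ const · `deKernel q |x|` with q =
γ(π/2) cos y, where γ is α on the left and β on the right. The kernel is the derivative of -exp(-q
sinh x), so its integral over (0, ∞) is 1.

Discretization: by Poisson summation the error is the sum of the Fourier transform of F over the
nonzero frequencies. Shifting the contour to height ±c makes these geometrically small, and c → d
yields exp(-2πd/h) = exp(-2πdn/L) (`integrable_and_summable_and_trapezoidal_le`).

Truncation: where the kernel decreases, its tail sum is at most exp(-q sinh(Mh)), which the choice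
of M makes at most e^{πα/4} e^{-2πdn}, better than required. For small γ the threshold lies to the
left of the maximum of the kernel, so the integral comparison loses something. The slack between
2πdn and 2πdn/L pays for the loss (`mode_bound`, `sum_deKernel_tail_le`). -/

/-! ### Lower bound for cosh((π/2) sinh ζ) on the strip. -/

lemma one_add_sq_div_two_le_cosh (a : ℝ) : 1 + a ^ 2 / 2 ≤ cosh a := by
  wlog ha : 0 ≤ a generalizing a
  · simpa using this (-a) (by linarith)
  have h1 : a / 2 ≤ sinh (a / 2) := self_le_sinh_iff.2 (by linarith)
  have h2 := cosh_two_mul (a / 2)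
  rw [cosh_sq, mul_div_cancel₀ a two_ne_zero] at h2
  nlinarith

/-- The graph of `|sin|` to the right of `c` lies below the tangent line of `sin` at `c`. -/
lemma abs_sin_le_tangent {c b : ℝ} (hc0 : 0 ≤ c) (hc : c ≤ π / 2) (hb : c ≤ b) :
    |sin b| ≤ sin c + (b - c) * cos c := by
  have hcos : 0 ≤ cos c := cos_nonneg_of_neg_pi_div_two_le_of_le (by linarith) hc
  have key : ∀ b, c ≤ b → b ≤ π / 2 → sin b ≤ sin c + (b - c) * cos c := by
    intro b h1 h2
    have hsc : 0 ≤ sin c := sin_nonneg_of_nonneg_of_le_pi hc0 (by linarith)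
    have h3 : sin (b - c) ≤ b - c := sin_le (by linarith)
    calc sin b = sin c * cos (b - c) + cos c * sin (b - c) := by
          rw [← sin_add, add_sub_cancel]
      _ ≤ sin c * 1 + cos c * (b - c) := by
          gcongr
          exact cos_le_one _
      _ = _ := by ring
  rcases le_total b (π / 2) with h | h
  · rw [abs_of_nonneg (sin_nonneg_of_nonneg_of_le_pi (by linarith) (by linarith))]
    exact key b hb h
  · have h1 := key (π / 2) hc le_rfl
    rw [sin_pi_div_two] at h1
    have h2 := abs_sin_le_one b
    nlinarith [mul_le_mul_of_nonneg_right h hcos]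

/-- Multiply cos c ≤ π/2 - c by Jordan's inequality in the form c ≤ (π/2 + c) sin c. The factor
(π/2)² - c² is the one that appears in a² in `abs_sin_mul_cosh_le`. -/
lemma mul_cos_le_sin {c : ℝ} (hc0 : 0 ≤ c) (hc : c ≤ π / 2) :
    c * cos c ≤ ((π / 2) ^ 2 - c ^ 2) * sin c := by
  have h1 : cos c ≤ π / 2 - c := by
    rw [← sin_pi_div_two_sub]
    exact sin_le (by linarith)
  have h2 : 2 / π * c ≤ sin c := mul_le_sin hc0 hc
  have hpi := pi_pos
  have h3 : c ≤ (π / 2 + c) * sin c := by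
    calc c ≤ (π / 2 + c) * (2 / π * c) := by
          have : (π / 2 + c) * (2 / π * c) = c + 2 / π * c ^ 2 := by field_simp
          rw [this]
          have : 0 ≤ 2 / π * c ^ 2 := by positivity
          linarith
      _ ≤ _ := by gcongr
  calc c * cos c ≤ c * (π / 2 - c) := by gcongr
    _ ≤ ((π / 2 + c) * sin c) * (π / 2 - c) := by
        apply mul_le_mul_of_nonneg_right h3; linarith
    _ = _ := by ring

/-- With c = (π/2) sin y and a = (π/2) sinh x cos y, the tangent line at c bounds the left side by
sin c + c cos c (cosh x - 1). This is compared with sin c (1 + a²/2), using a² = ((π/2)² - c²)(cosh²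
x - 1) and cosh x - 1 ≤ (cosh² x - 1)/2. -/
lemma abs_sin_mul_cosh_le {y : ℝ} (hy : |y| ≤ π / 2) (x : ℝ) :
    |sin (π / 2 * (cosh x * sin y))| ≤
      |sin (π / 2 * sin y)| * cosh (π / 2 * (sinh x * cos y)) := by
  have hpi := pi_pos
  wlog hy0 : 0 ≤ y generalizing y
  · have := this (y := -y) (by simpa using hy) (by linarith)
    simpa using this
  rw [abs_of_nonneg hy0] at hy
  have hs0 : 0 ≤ sin y := sin_nonneg_of_nonneg_of_le_pi hy0 (by linarith)
  have hs1 : sin y ≤ 1 := sin_le_one y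
  set c := π / 2 * sin y with hc
  have hc0 : 0 ≤ c := by positivity
  have hc1 : c ≤ π / 2 := by nlinarith
  have hsc : 0 ≤ sin c := sin_nonneg_of_nonneg_of_le_pi hc0 (by linarith)
  have hch := one_le_cosh x
  have e : π / 2 * (cosh x * sin y) = c * cosh x := by rw [hc]; ring
  rw [e, abs_of_nonneg hsc]
  have h1 := abs_sin_le_tangent hc0 hc1 (b := c * cosh x) (by nlinarith)
  have h2 := mul_cos_le_sin hc0 hc1
  set a := π / 2 * (sinh x * cos y) with ha
  have h3 : 1 + a ^ 2 / 2 ≤ cosh a := one_add_sq_div_two_le_cosh a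
  have h4 : a ^ 2 = ((π / 2) ^ 2 - c ^ 2) * (cosh x ^ 2 - 1) := by
    rw [ha, hc, cosh_sq]
    have := cos_sq' y
    linear_combination (π / 2) ^ 2 * sinh x ^ 2 * this
  have hq : 0 ≤ (π / 2) ^ 2 - c ^ 2 := by nlinarith
  calc |sin (c * cosh x)| ≤ sin c + (c * cos c) * (cosh x - 1) := by
        convert h1 using 1; ring
    _ ≤ sin c + (((π / 2) ^ 2 - c ^ 2) * sin c) * (cosh x - 1) := by
        gcongr
    _ ≤ sin c * (1 + a ^ 2 / 2) := by
        rw [h4]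
        have : 0 ≤ ((π / 2) ^ 2 - c ^ 2) * sin c * (cosh x - 1) ^ 2 := by positivity
        nlinarith
    _ ≤ _ := by gcongr

lemma norm_cosh_sq (a b : ℝ) :
    ‖Complex.cosh (a + b * Complex.I)‖ ^ 2 = cosh a ^ 2 - sin b ^ 2 := by
  have h : Complex.cosh (a + b * Complex.I) =
      (cosh a * cos b : ℝ) + (sinh a * sin b : ℝ) * Complex.I := by
    rw [Complex.cosh_add, Complex.cosh_mul_I, Complex.sinh_mul_I]
    push_cast
    ring
  rw [h, ← Complex.normSq_eq_norm_sq, Complex.normSq_add_mul_I, mul_pow, mul_pow, cosh_sq, cos_sq']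
  ring

lemma half_pi_mul_sinh (x y : ℝ) :
    (π / 2 : ℂ) * Complex.sinh (x + y * Complex.I) =
      (π / 2 * (sinh x * cos y) : ℝ) + (π / 2 * (cosh x * sin y) : ℝ) * Complex.I := by
  rw [Complex.sinh_add, Complex.cosh_mul_I, Complex.sinh_mul_I]
  push_cast
  ring

lemma cos_half_pi_sin_pos {y : ℝ} (hy : |y| < π / 2) : 0 < cos (π / 2 * sin y) := by
  have hpi := pi_pos
  have h1 : |sin y| < 1 := by
    rw [← sq_lt_one_iff_abs_lt_one, sin_sq]
    have := cos_pos_of_mem_Ioo (x := y) ⟨by linarith [(abs_lt.1 hy).1], (abs_lt.1 hy).2⟩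
    nlinarith
  rw [abs_lt] at h1
  exact cos_pos_of_mem_Ioo ⟨by nlinarith, by nlinarith⟩

/-- Lower bound for `cosh ((π / 2) sinh ζ)` by a product of real functions. -/
lemma cosh_mul_cos_le_norm_cosh {y : ℝ} (hy : |y| < π / 2) (x : ℝ) :
    cosh (π / 2 * (sinh x * cos y)) * cos (π / 2 * sin y) ≤
      ‖Complex.cosh ((π / 2 : ℂ) * Complex.sinh (x + y * Complex.I))‖ := by
  rw [half_pi_mul_sinh]
  apply le_of_sq_le_sq _ (norm_nonneg _)
  rw [norm_cosh_sq, mul_pow, cos_sq']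
  have h := abs_sin_mul_cosh_le hy.le x
  have h2 : sin (π / 2 * (cosh x * sin y)) ^ 2 ≤
      sin (π / 2 * sin y) ^ 2 * cosh (π / 2 * (sinh x * cos y)) ^ 2 := by
    rw [← sq_abs, ← sq_abs (sin (π / 2 * sin y)), ← mul_pow]
    gcongr
  linarith

/-! ### The transformed integrand and its double-exponential majorant. -/

lemma hasDerivAt_deMap (z : ℂ) :
    HasDerivAt deMap ((π / 2 : ℂ) * Complex.cosh z *
      Complex.cosh ((π / 2 : ℂ) * Complex.sinh z)) z := by
  have h := ((Complex.hasDerivAt_sinh z).const_mul (π / 2 : ℂ)).csinh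
  unfold deMap
  convert h using 1
  ring

lemma deriv_deMap (z : ℂ) : deriv deMap z = (π / 2 : ℂ) * Complex.cosh z *
      Complex.cosh ((π / 2 : ℂ) * Complex.sinh z) := (hasDerivAt_deMap z).deriv

lemma norm_E₁_deMap (z : ℂ) (γ : ℝ) :
    ‖E₁ (deMap z) γ‖ = (‖Complex.cosh ((π / 2 : ℂ) * Complex.sinh z)‖ ^ (γ + 1))⁻¹ := by
  have h : 1 + deMap z ^ 2 = Complex.cosh ((π / 2 : ℂ) * Complex.sinh z) ^ 2 := by
    rw [deMap, Complex.cosh_sq]; ring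
  rw [E₁, h, norm_div, norm_one, Complex.norm_cpow_real, norm_pow,
    ← rpow_natCast_mul (norm_nonneg _), one_div]
  push_cast
  rw [mul_div_cancel₀ _ two_ne_zero]

lemma norm_cosh_le (x y : ℝ) : ‖Complex.cosh (x + y * Complex.I)‖ ≤ cosh x := by
  apply le_of_sq_le_sq _ (cosh_pos x).le
  rw [norm_cosh_sq]
  nlinarith [sq_nonneg (sin y)]

lemma exp_abs_le_two_mul_cosh (a : ℝ) : exp |a| ≤ 2 * cosh a := by
  rw [← cosh_abs, cosh_eq]
  have := exp_pos (-|a|)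
  linarith

/-- The integrand after the variable transformation. -/
def transformed (f : ℂ → ℂ) (z : ℂ) : ℂ := f (deMap z) * deriv deMap z

/-- The majorant of the transformed integrand on a horizontal line, up to a constant factor. -/
def deKernel (q x : ℝ) : ℝ := q * cosh x * exp (-(q * sinh x))

/-- One power of W = |cosh((π/2) sinh z)| cancels against ψ', leaving W^(-γ). The divisor γ cos y in
the constant compensates for the factor q in `deKernel`, which is there to normalize its integral.
-/
lemma norm_transformed_le {f : ℂ → ℂ} {K γ x y : ℝ} (hK : 0 < K) (hγ : 0 < γ) (hy : |y| < π / 2)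
    (hf : ‖f (deMap (x + y * Complex.I))‖ ≤ K * ‖E₁ (deMap (x + y * Complex.I)) γ‖) :
    ‖transformed f (x + y * Complex.I)‖ ≤
      K * 2 ^ γ / γ / (cos (π / 2 * sin y) ^ γ * cos y) * deKernel (γ * (π / 2) * cos y) |x| := by
  have hpi := pi_pos
  set z : ℂ := x + y * Complex.I
  have hcy : 0 < cos y := cos_pos_of_mem_Ioo ⟨by linarith [(abs_lt.1 hy).1], (abs_lt.1 hy).2⟩
  have hcc := cos_half_pi_sin_pos hy
  set W := ‖Complex.cosh ((π / 2 : ℂ) * Complex.sinh z)‖ with hW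
  have hlow := cosh_mul_cos_le_norm_cosh hy x
  have hlow2 : exp (π / 2 * cos y * sinh |x|) / 2 * cos (π / 2 * sin y) ≤ W := by
    refine le_trans ?_ hlow
    gcongr
    have := exp_abs_le_two_mul_cosh (π / 2 * (sinh x * cos y))
    rw [abs_mul, abs_mul, abs_of_pos hcy, abs_of_pos (by positivity : 0 < π / 2),
      abs_sinh] at this
    rw [show π / 2 * cos y * sinh |x| = π / 2 * (sinh |x| * cos y) by ring]
    linarith
  have hWpos : 0 < W := lt_of_lt_of_le (by positivity) hlow2
  rw [norm_E₁_deMap] at hf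
  have hpow : exp (γ * (π / 2) * cos y * sinh |x|) / 2 ^ γ * cos (π / 2 * sin y) ^ γ ≤ W ^ γ := by
    have := rpow_le_rpow (by positivity) hlow2 hγ.le
    rw [mul_rpow (by positivity) hcc.le, div_rpow (exp_pos _).le (by norm_num), ← exp_mul] at this
    convert this using 4
    ring
  have hchx := norm_cosh_le x y
  rw [transformed, norm_mul, deriv_deMap, norm_mul, norm_mul, ← hW]
  have hpin : ‖(π / 2 : ℂ)‖ = π / 2 := by
    rw [norm_div, Complex.norm_real, norm_of_nonneg hpi.le]; simp
  rw [hpin]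
  calc ‖f (deMap z)‖ * (π / 2 * ‖Complex.cosh z‖ * W)
      ≤ (K * (W ^ (γ + 1))⁻¹) * (π / 2 * cosh x * W) := by gcongr
    _ = K * (π / 2) * cosh x * (W ^ γ)⁻¹ := by
        rw [rpow_add hWpos, rpow_one]; field_simp
    _ ≤ K * (π / 2) * cosh x *
        (exp (γ * (π / 2) * cos y * sinh |x|) / 2 ^ γ * cos (π / 2 * sin y) ^ γ)⁻¹ := by
        have := cosh_pos x
        gcongr
    _ = _ := by
        rw [deKernel, cosh_abs, exp_neg]
        field_simp

/-! ### Contour shift, Fourier decay and the trapezoidal rule. -/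

/-- Moving a line of integration inside a horizontal strip. -/
lemma integral_horizontal_shift {G : ℂ → ℂ} {g : ℝ → ℝ} {c : ℝ}
    (hG : DifferentiableOn ℂ G {z | z.im ∈ Set.uIcc 0 c})
    (hg : ∀ x y : ℝ, y ∈ Set.uIcc 0 c → ‖G (x + y * Complex.I)‖ ≤ g x)
    (hgi : Integrable g) (hg0 : Tendsto g (cocompact ℝ) (𝓝 0)) :
    ∫ x : ℝ, G x = ∫ x : ℝ, G (x + c * Complex.I) := by
  have hcont : ∀ y ∈ Set.uIcc 0 c, Continuous fun x : ℝ => G (x + y * Complex.I) := by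
    intro y hy
    refine hG.continuousOn.comp_continuous (by fun_prop) fun x => ?_
    simpa using hy
  have hint : ∀ y ∈ Set.uIcc 0 c, Integrable fun x : ℝ => G (x + y * Complex.I) := fun y hy =>
    hgi.mono' (hcont y hy).aestronglyMeasurable (Eventually.of_forall fun x => hg x y hy)
  have h0 := hint 0 Set.left_mem_uIcc
  have hc := hint c Set.right_mem_uIcc
  simp only [Complex.ofReal_zero, zero_mul, add_zero] at h0
  rw [cocompact_eq_atBot_atTop, tendsto_sup] at hg0
  have hvert : ∀ l : Filter ℝ, Tendsto g l (𝓝 0) →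
      Tendsto (fun T : ℝ => Complex.I • ∫ y in (0 : ℝ)..c, G (T + y * Complex.I)) l (𝓝 0) := by
    intro l hl
    rw [← smul_zero (M := ℂ) (A := ℂ) Complex.I]
    refine Tendsto.const_smul ?_ Complex.I
    refine squeeze_zero_norm (fun T => intervalIntegral.norm_integral_le_of_norm_le_const
      (C := g T) fun y hy => hg T y (Set.uIoc_subset_uIcc hy)) ?_
    simpa using hl.mul_const |c - 0|
  have hlim1 := intervalIntegral_tendsto_integral h0 tendsto_neg_atTop_atBot tendsto_id
  have hlim2 := intervalIntegral_tendsto_integral hc tendsto_neg_atTop_atBot tendsto_id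
  have hlim := ((hlim1.sub hlim2).add (hvert _ hg0.2)).sub
    ((hvert _ hg0.1).comp tendsto_neg_atTop_atBot)
  have hz : ∀ T : ℝ, ((((∫ x in (-T)..(id T), G x) - ∫ x in (-T)..(id T), G (x + c * Complex.I)) +
      Complex.I • ∫ y in (0 : ℝ)..c, G (T + y * Complex.I)) -
      Complex.I • ∫ y in (0 : ℝ)..c, G ((-T : ℝ) + y * Complex.I)) = 0 := by
    intro T
    have := Complex.integral_boundary_rect_eq_zero_of_differentiableOn G (-T : ℝ)
      (T + c * Complex.I) (hG.mono fun z hz => by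
        have := (Complex.mem_reProdIm.1 hz).2
        simpa using this)
    simpa using this
  have h2 := tendsto_nhds_unique (hlim.congr hz) tendsto_const_nhds
  simpa [sub_eq_zero] using h2

/-- The line is moved up or down according to the sign of ξ, so that on it the modulus of e^{-2πizξ}
is exp(-2πc|ξ|). -/
lemma norm_fourier_le {F : ℂ → ℂ} {g : ℝ → ℝ} {c I : ℝ} (hc : 0 < c)
    (hF : DifferentiableOn ℂ F {z | |z.im| ≤ c})
    (hg : ∀ x y : ℝ, |y| ≤ c → ‖F (x + y * Complex.I)‖ ≤ g x)
    (hgi : Integrable g) (hg0 : Tendsto g (cocompact ℝ) (𝓝 0))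
    (hI : ∀ y : ℝ, |y| = c → ∫ x : ℝ, ‖F (x + y * Complex.I)‖ ≤ I) (ξ : ℝ) :
    ‖𝓕 (fun x : ℝ => F x) ξ‖ ≤ I * exp (-(2 * π * c * |ξ|)) := by
  obtain ⟨s, hs, hsξ⟩ : ∃ s : ℝ, |s| = 1 ∧ s * ξ = -|ξ| := by
    rcases le_total 0 ξ with h | h
    · exact ⟨-1, by simp, by rw [abs_of_nonneg h]; ring⟩
    · exact ⟨1, by simp, by rw [abs_of_nonpos h]; ring⟩
  have hsc : |s * c| = c := by rw [abs_mul, hs, one_mul, abs_of_pos hc]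
  set G : ℂ → ℂ := fun z => Complex.exp (-2 * π * z * ξ * Complex.I) * F z with hGdef
  have hGn : ∀ x y : ℝ, ‖G (x + y * Complex.I)‖ =
      exp (2 * π * y * ξ) * ‖F (x + y * Complex.I)‖ := by
    intro x y
    simp only [hGdef]
    rw [norm_mul, Complex.norm_exp]
    congr 2
    simp
  have habs : ∀ y ∈ Set.uIcc 0 (s * c), |y| ≤ c := by
    intro y hy
    have := Set.abs_sub_left_of_mem_uIcc hy
    simpa [hsc] using this
  have hshift := integral_horizontal_shift (G := G) (c := s * c)
    (g := fun x => exp (2 * π * c * |ξ|) * g x)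
    (by
      refine DifferentiableOn.mul (Differentiable.differentiableOn (by fun_prop))
        (hF.mono fun z hz => habs _ hz))
    (fun x y hy => by
      rw [hGn]
      have h1 := hg x y (habs y hy)
      have h2 : y * ξ ≤ c * |ξ| := by
        calc y * ξ ≤ |y| * |ξ| := by rw [← abs_mul]; exact le_abs_self _
          _ ≤ _ := by gcongr; exact habs y hy
      have h3 : 2 * π * y * ξ ≤ 2 * π * c * |ξ| := by
        rw [mul_assoc, mul_assoc (2 * π)]
        gcongr
      exact mul_le_mul (exp_le_exp.2 h3) h1 (norm_nonneg _) (exp_pos _).le)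
    (hgi.const_mul _) (by simpa using hg0.const_mul (exp (2 * π * c * |ξ|)))
  rw [Real.fourier_real_eq_integral_exp_smul]
  have e : (∫ v : ℝ, Complex.exp (↑(-2 * π * v * ξ) * Complex.I) • F v) = ∫ x : ℝ, G x := by
    congr 1
    ext v
    simp [hGdef]
  rw [e, hshift]
  refine (norm_integral_le_integral_norm _).trans ?_
  simp_rw [hGn]
  rw [integral_const_mul, mul_comm, show 2 * π * (s * c) * ξ = -(2 * π * c * |ξ|) by
    linear_combination 2 * π * c * hsξ]
  gcongr
  exact hI _ hsc

/-- The trapezoidal rule with unit step for functions analytic in a strip. -/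
lemma norm_integral_sub_tsum_int_le {F : ℂ → ℂ} {g : ℝ → ℝ} {c I : ℝ} (hc : 0 < c)
    (hF : DifferentiableOn ℂ F {z | |z.im| ≤ c})
    (hg : ∀ x y : ℝ, |y| ≤ c → ‖F (x + y * Complex.I)‖ ≤ g x)
    (hgi : Integrable g) (hgO : g =O[cocompact ℝ] fun x => |x| ^ (-2 : ℝ))
    (hI : ∀ y : ℝ, |y| = c → ∫ x : ℝ, ‖F (x + y * Complex.I)‖ ≤ I) :
    Summable (fun k : ℤ => F (k : ℝ)) ∧ ‖(∫ x : ℝ, F x) - ∑' k : ℤ, F (k : ℝ)‖ ≤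
      2 * I * (exp (-(2 * π * c)) / (1 - exp (-(2 * π * c)))) := by
  have hg0 : Tendsto g (cocompact ℝ) (𝓝 0) := by
    refine hgO.trans_tendsto ?_
    exact (tendsto_rpow_neg_atTop (by norm_num)).comp (tendsto_norm_cocompact_atTop (E := ℝ))
  have hfour := norm_fourier_le hc hF hg hgi hg0 hI
  have hcont : Continuous fun x : ℝ => F x := by
    refine hF.continuousOn.comp_continuous (by fun_prop) fun x => ?_
    simpa using hc.le
  have hFO : (fun x : ℝ => F x) =O[cocompact ℝ] fun x => |x| ^ (-2 : ℝ) := by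
    refine (IsBigO.of_bound 1 (Eventually.of_forall fun x => ?_)).trans hgO
    have := hg x 0 (by simpa using hc.le)
    simp only [Complex.ofReal_zero, zero_mul, add_zero] at this
    rw [one_mul]
    exact this.trans (le_abs_self _)
  set r := exp (-(2 * π * c)) with hr
  have hr0 : 0 < r := exp_pos _
  have hr1 : r < 1 := by
    rw [hr, exp_lt_one_iff]
    have := pi_pos
    have : 0 < 2 * π * c := by positivity
    linarith
  have hgeo : HasSum (fun n : ℕ => I * r ^ (n + 1)) (I * (r / (1 - r))) := by
    have := (hasSum_geometric_of_lt_one hr0.le hr1).mul_left (I * r)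
    have e : (fun n : ℕ => I * r ^ (n + 1)) = fun n => I * r * r ^ n := by
      funext n
      ring
    rwa [e, div_eq_mul_inv, ← mul_assoc]
  set φ := 𝓕 (fun x : ℝ => F x) with hφ
  have hb1 : ∀ n : ℕ, ‖φ ((n : ℝ) + 1)‖ ≤ I * r ^ (n + 1) := by
    intro n
    refine (hfour _).trans (le_of_eq ?_)
    rw [hr, ← exp_nat_mul, abs_of_pos (by positivity)]
    push_cast
    ring_nf
  have hb2 : ∀ n : ℕ, ‖φ (-((n : ℝ) + 1))‖ ≤ I * r ^ (n + 1) := by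
    intro n
    refine (hfour _).trans (le_of_eq ?_)
    rw [hr, ← exp_nat_mul, abs_neg, abs_of_pos (by positivity)]
    push_cast
    ring_nf
  have hs1 : Summable fun n : ℕ => φ ((n : ℝ) + 1) := Summable.of_norm_bounded hgeo.summable hb1
  have hs2 : Summable fun n : ℕ => φ (-((n : ℝ) + 1)) :=
    Summable.of_norm_bounded hgeo.summable hb2
  have hs0 : Summable fun n : ℕ => φ (n : ℝ) := by
    rw [← summable_nat_add_iff 1]
    simpa using hs1
  have hsZ : HasSum (fun m : ℤ => φ (m : ℝ))
      ((∑' n : ℕ, φ (n : ℝ)) + ∑' n : ℕ, φ (-((n : ℝ) + 1))) := by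
    refine HasSum.of_nat_of_neg_add_one ?_ ?_
    · simpa using hs0.hasSum
    · simpa using hs2.hasSum
  -- Poisson summation at the point 0; its zero-frequency term is ∫ F, so the error consists of the
  -- frequencies ±(n + 1).
  have hpois := Real.tsum_eq_tsum_fourier_of_rpow_decay_of_summable hcont one_lt_two hFO
    hsZ.summable 0
  simp only [zero_add, QuotientAddGroup.mk_zero, fourier_eval_zero, mul_one] at hpois
  rw [← hφ, hsZ.tsum_eq, hs0.tsum_eq_zero_add] at hpois
  have hφ0 : φ ((0 : ℕ) : ℝ) = ∫ x : ℝ, F x := by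
    rw [hφ, Real.fourier_real_eq_integral_exp_smul]
    simp
  rw [hφ0] at hpois
  refine ⟨?_, ?_⟩
  · exact summable_of_isBigO (Real.summable_abs_int_rpow one_lt_two)
      (hFO.comp_tendsto Int.tendsto_coe_cofinite)
  · rw [hpois]
    have h1 := tsum_of_norm_bounded hgeo hb1
    have h2 := tsum_of_norm_bounded hgeo hb2
    push_cast
    rw [add_assoc, sub_add_cancel_left, norm_neg]
    refine (norm_add_le _ _).trans ((add_le_add h1 h2).trans (le_of_eq ?_))
    ring

/-- The trapezoidal rule with step `h` for functions analytic in a strip. -/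
lemma norm_integral_sub_tsum_le {F : ℂ → ℂ} {g : ℝ → ℝ} {c I h : ℝ} (hc : 0 < c) (hh : 0 < h)
    (hF : DifferentiableOn ℂ F {z | |z.im| ≤ c})
    (hg : ∀ x y : ℝ, |y| ≤ c → ‖F (x + y * Complex.I)‖ ≤ g x)
    (hgi : Integrable g) (hgO : g =O[cocompact ℝ] fun x => |x| ^ (-2 : ℝ))
    (hI : ∀ y : ℝ, |y| = c → ∫ x : ℝ, ‖F (x + y * Complex.I)‖ ≤ I) :
    Summable (fun k : ℤ => F ((k : ℝ) * h : ℝ)) ∧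
      ‖(∫ x : ℝ, F x) - h * ∑' k : ℤ, F ((k : ℝ) * h : ℝ)‖ ≤
      2 * I * (exp (-(2 * π * c / h)) / (1 - exp (-(2 * π * c / h)))) := by
  have key := norm_integral_sub_tsum_int_le (F := fun z => h * F (h * z)) (c := c / h) (I := I)
    (g := fun x => h * g (h * x)) (by positivity) ?_ ?_ ?_ ?_ ?_
  · have h0 : (h : ℂ) ≠ 0 := by exact_mod_cast hh.ne'
    have e1 : ∀ k : ℤ, (h : ℂ) * F (h * ((k : ℝ) : ℂ)) = h * F ((k : ℝ) * h : ℝ) := by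
      intro k
      push_cast
      rw [mul_comm (h : ℂ) (k : ℂ)]
    simp only [e1] at key
    rw [tsum_mul_left] at key
    refine ⟨(summable_mul_left_iff h0).1 key.1, ?_⟩
    convert key.2 using 2
    · congr 1
      rw [integral_const_mul]
      have := Measure.integral_comp_mul_left (fun x : ℝ => F x) h
      simp only [Complex.ofReal_mul] at this
      rw [this, abs_of_pos (inv_pos.2 hh)]
      simp [h0]
    · rw [mul_div_assoc]
  · refine DifferentiableOn.const_mul ?_ _
    refine hF.comp (Differentiable.differentiableOn (by fun_prop)) fun z hz => ?_
    simp only [Set.mem_ofPred_eq, Complex.im_ofReal_mul, abs_mul,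
      abs_of_pos hh] at hz ⊢
    rwa [le_div_iff₀' hh] at hz
  · intro x y hy
    rw [norm_mul, Complex.norm_real, norm_of_nonneg hh.le]
    gcongr
    have e : (h : ℂ) * (x + y * Complex.I) = (h * x : ℝ) + (h * y : ℝ) * Complex.I := by
      push_cast; ring
    rw [e]
    refine hg (h * x) (h * y) ?_
    rwa [abs_mul, abs_of_pos hh, ← le_div_iff₀' hh]
  · exact (hgi.comp_mul_left' hh.ne').const_mul h
  · refine IsBigO.const_mul_left ?_ _
    refine (hgO.comp_tendsto (k := fun x => h * x) ?_).trans ?_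
    · exact (Homeomorph.mulLeft₀ h hh.ne').isClosedEmbedding.tendsto_cocompact
    · refine IsBigO.of_bound (h ^ (-2 : ℝ)) (Eventually.of_forall fun x => ?_)
      simp only [Function.comp]
      rw [abs_mul, mul_rpow (abs_nonneg _) (abs_nonneg _), norm_mul, abs_of_pos hh,
        norm_of_nonneg (by positivity)]
  · intro y hy
    refine le_trans (le_of_eq ?_) (hI (h * y) ?_)
    · have := Measure.integral_comp_mul_left
        (fun x : ℝ => ‖F (x + (h * y : ℝ) * Complex.I)‖) h
      rw [abs_of_pos (inv_pos.2 hh), eq_inv_smul_iff₀ hh.ne', smul_eq_mul] at this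
      rw [← this, ← integral_const_mul]
      congr 1
      ext x
      rw [norm_mul, Complex.norm_real, norm_of_nonneg hh.le]
      congr 3
      push_cast
      ring
    · rw [abs_mul, abs_of_pos hh, hy]; field_simp

/-! ### Monotonicity of the kernel and comparison of sums with integrals. -/

lemma hasDerivAt_neg_exp_neg_mul_sinh (q x : ℝ) :
    HasDerivAt (fun x => -exp (-(q * sinh x))) (deKernel q x) x := by
  have h := ((((hasDerivAt_sinh x).const_mul q).fun_neg).exp).fun_neg
  refine h.congr_deriv ?_
  rw [deKernel]; ring

lemma continuous_deKernel (q : ℝ) : Continuous (deKernel q) := by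
  unfold deKernel
  fun_prop

lemma hasDerivAt_deKernel (q x : ℝ) :
    HasDerivAt (deKernel q) (q * exp (-(q * sinh x)) * (sinh x - q * cosh x ^ 2)) x := by
  have h1 := (((hasDerivAt_sinh x).const_mul q).fun_neg).exp
  have h := ((hasDerivAt_cosh x).const_mul q).fun_mul h1
  refine h.congr_deriv ?_
  ring

lemma deKernel_nonneg {q : ℝ} (hq : 0 ≤ q) (x : ℝ) : 0 ≤ deKernel q x := by
  have := cosh_pos x
  unfold deKernel
  positivity

lemma antitoneOn_deKernel {q t : ℝ} (hq : 0 ≤ q) (ht : ∀ x, t ≤ x → sinh x ≤ q * cosh x ^ 2) :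
    AntitoneOn (deKernel q) (Set.Ici t) := by
  refine antitoneOn_of_deriv_nonpos (convex_Ici t) (continuous_deKernel q).continuousOn
    (fun x _ => (hasDerivAt_deKernel q x).differentiableAt.differentiableWithinAt) fun x hx => ?_
  rw [interior_Ici] at hx
  rw [(hasDerivAt_deKernel q x).deriv]
  exact mul_nonpos_of_nonneg_of_nonpos (by positivity) (sub_nonpos.2 (ht x (le_of_lt hx)))

lemma monotoneOn_deKernel {q a t : ℝ} (hq : 0 ≤ q)
    (ht : ∀ x ∈ Set.Icc a t, q * cosh x ^ 2 ≤ sinh x) :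
    MonotoneOn (deKernel q) (Set.Icc a t) := by
  refine monotoneOn_of_deriv_nonneg (convex_Icc a t) (continuous_deKernel q).continuousOn
    (fun x _ => (hasDerivAt_deKernel q x).differentiableAt.differentiableWithinAt) fun x hx => ?_
  rw [(hasDerivAt_deKernel q x).deriv]
  exact mul_nonneg (by positivity) (sub_nonneg.2 (ht x (interior_subset hx)))

lemma mul_deKernel_le_sub {q t x y : ℝ} (ha : AntitoneOn (deKernel q) (Set.Ici t)) (htx : t ≤ x)
    (hxy : x ≤ y) :
    (y - x) * deKernel q y ≤ exp (-(q * sinh x)) - exp (-(q * sinh y)) := by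
  have h := (convex_Icc x y).mul_sub_le_image_sub_of_le_deriv
    (f := fun x => -exp (-(q * sinh x))) (C := deKernel q y)
    (fun z _ => (hasDerivAt_neg_exp_neg_mul_sinh q z).continuousAt.continuousWithinAt)
    (fun z _ => (hasDerivAt_neg_exp_neg_mul_sinh q z).differentiableAt.differentiableWithinAt)
    (fun z hz => by
      rw [interior_Icc] at hz
      rw [(hasDerivAt_neg_exp_neg_mul_sinh q z).deriv]
      exact ha (htx.trans hz.1.le) (htx.trans hxy) hz.2.le)
    x (Set.left_mem_Icc.2 hxy) y (Set.right_mem_Icc.2 hxy) hxy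
  linarith

/-- Comparison of a sum with an integral for a function that may first increase up to `t`. -/
lemma sum_deKernel_le {q a t h : ℝ} (hh : 0 < h) (hq : 0 ≤ q) (hat : a ≤ t)
    (hmax : ∀ x ∈ Set.Icc a t, deKernel q x ≤ deKernel q t)
    (ha : AntitoneOn (deKernel q) (Set.Ici t)) (m : ℕ) :
    ∑ k ∈ Finset.range m, h * deKernel q (a + (k + 1) * h) ≤
      (t - a) * deKernel q t + exp (-(q * sinh t)) := by
  -- A is the integral from x to ∞ of the nonincreasing envelope of the kernel, equal to its maximum
  -- up to t. Each summand is bounded by a decrement of A, so the sum telescopes.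
  set A : ℝ → ℝ := fun x => if x ≤ t then (t - x) * deKernel q t + exp (-(q * sinh t)) else
    exp (-(q * sinh x)) with hA
  have hAnn : ∀ x, 0 ≤ A x := by
    intro x
    simp only [hA]
    split_ifs with hx
    · have := deKernel_nonneg hq t
      have : 0 ≤ t - x := by linarith
      positivity
    · positivity
  have hstep : ∀ x, a ≤ x → h * deKernel q (x + h) ≤ A x - A (x + h) := by
    intro x hx
    simp only [hA]
    by_cases h1 : x + h ≤ t
    · rw [if_pos h1, if_pos (by linarith)]
      have := mul_le_mul_of_nonneg_left (hmax (x + h) ⟨by linarith, h1⟩) hh.le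
      linarith
    · rw [if_neg h1]
      push Not at h1
      by_cases h2 : x ≤ t
      · rw [if_pos h2]
        have h3 := mul_deKernel_le_sub ha le_rfl h1.le
        have h4 := mul_le_mul_of_nonneg_left (ha Set.self_mem_Ici (Set.mem_Ici.2 h1.le) h1.le)
          (sub_nonneg.2 h2)
        linarith
      · rw [if_neg h2]
        push Not at h2
        have h3 := mul_deKernel_le_sub ha h2.le (y := x + h) (by linarith)
        linarith
  have hsum : ∑ k ∈ Finset.range m, h * deKernel q (a + (k + 1) * h) ≤ A a - A (a + m * h) := by
    induction m with
    | zero => simp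
    | succ m ih =>
      rw [Finset.sum_range_succ]
      have := hstep (a + m * h) (by have : 0 ≤ m * h := by positivity
                                    linarith)
      rw [show a + m * h + h = a + (m + 1) * h by ring] at this
      push_cast
      linarith
  have e : A a = (t - a) * deKernel q t + exp (-(q * sinh t)) := if_pos hat
  rw [← e]
  linarith [hAnn (a + m * h)]

/-! ### The truncation tail, including a start before the maximum. -/

lemma half_log_two_le : log 2 / 2 ≤ 0.34658 := by
  have := log_two_lt_d9
  norm_num at this ⊢
  linarith

/-- The constant 0.6534 is just below 1 - (log 2)/2, as `mode_bound` needs. On each interval max(1,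
t) is replaced by a lower bound c, reducing the claim to e^t (1 - 0.6534c) ≤ c; from t = 1.6 on the
left side is negative. -/
lemma exp_le_max_mul {t : ℝ} :
    exp t ≤ max 1 t * (0.6534 * exp t + 1) := by
  have he := exp_one_lt_d9
  have hexp : ∀ (j k : ℕ) (x b : ℝ), j ≠ 0 → 0 ≤ b → j * x = k →
      (2.7182818286 : ℝ) ^ k ≤ b ^ j → exp x ≤ b := by
    intro j k x b hj hb hjk h
    have h1 : exp (j * x) ≤ 2.7182818286 ^ k := by
      rw [hjk, ← mul_one (k : ℝ), exp_nat_mul]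
      gcongr
    rw [exp_nat_mul] at h1
    exact le_of_pow_le_pow_left₀ hj hb (h1.trans h)
  have key : ∀ u b c : ℝ, t ≤ u → exp u ≤ b → 1 ≤ c → c ≤ max 1 t → b * (1 - c * 0.6534) ≤ c →
      exp t ≤ max 1 t * (0.6534 * exp t + 1) := by
    intro u b c h1 h2 h3 h4 h5
    have h6 : exp t ≤ b := (exp_le_exp.2 h1).trans h2
    have h7 := exp_pos t
    have h8 : exp t ≤ c * (0.6534 * exp t + 1) := by
      rcases le_total 0 (1 - c * 0.6534) with h | h
      · nlinarith [mul_le_mul_of_nonneg_right h6 h]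
      · nlinarith [mul_nonpos_of_nonneg_of_nonpos h7.le h]
    exact h8.trans (by gcongr)
  rcases le_total t 1.05 with h | h
  · exact key 1.05 2.86 1 h (hexp 20 21 _ _ (by norm_num) (by norm_num) (by norm_num)
      (by norm_num)) le_rfl (le_max_left _ _) (by norm_num)
  rcases le_total t 1.2 with h' | h'
  · exact key 1.2 3.33 1.05 h' (hexp 5 6 _ _ (by norm_num) (by norm_num) (by norm_num)
      (by norm_num)) (by norm_num) (le_max_of_le_right h) (by norm_num)
  rcases le_total t 1.6 with h'' | h''
  · exact key 1.6 5 1.2 h'' (hexp 5 8 _ _ (by norm_num) (by norm_num) (by norm_num)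
      (by norm_num)) (by norm_num) (le_max_of_le_right h') (by norm_num)
  · exact key t (exp t) 1.6 le_rfl le_rfl (by norm_num) (le_max_of_le_right h'')
      (by have := exp_pos t
          nlinarith)

lemma exp_mul_max_le {x t : ℝ} (hxt : x ≤ t) : exp x * max 1 t ≤ exp t * max 1 x := by
  have h1 : max 1 t ≤ exp (t - x) * max 1 x := by
    have h2 := add_one_le_exp (t - x)
    have h3 : 1 ≤ max 1 x := le_max_left _ _
    have h4 : x ≤ max 1 x := le_max_right _ _
    apply max_le
    · nlinarith
    · nlinarith
  calc exp x * max 1 t ≤ exp x * (exp (t - x) * max 1 x) := by gcongr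
    _ = _ := by rw [← mul_assoc, ← exp_add]; congr 2; ring

lemma sub_le_log_of_sinh_le {x t ρ : ℝ} (hx : 0 < x) (hxt : x ≤ t) (h : sinh t ≤ ρ * sinh x) :
    t - x ≤ log ρ := by
  have hs : 0 < sinh x := sinh_pos_iff.2 hx
  have h1 : exp (t - x) * sinh x ≤ sinh t := by
    rw [sinh_eq, sinh_eq]
    have h2 : exp (t - x) * exp x = exp t := by rw [← exp_add]; congr 1; ring
    have h3 : exp (-t) ≤ exp (t - x) * exp (-x) := by
      rw [← exp_add]; exact exp_le_exp.2 (by linarith)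
    linarith
  have h4 : exp (t - x) ≤ ρ := le_of_mul_le_mul_right (h1.trans h) hs
  rw [le_log_iff_exp_le ((exp_pos _).trans_le h4)]
  exact h4

/-- Here q sinh x = (q/2)e^x - (q/2)e^{-x} ≥ D - q/2, which is the source of exp(q/2), and hence of
e^{πν/4} in `C₁`. -/
lemma exp_neg_mul_sinh_le {q x D L : ℝ} (hD0 : 0 ≤ D) (hD : D ≤ q / 2 * exp x) (hL : 1 ≤ L)
    (hx : 0 ≤ x) (hq : 0 ≤ q) : exp (-(q * sinh x)) ≤ exp (q / 2) * exp (-(D / L)) := by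
  rw [← exp_add]
  apply exp_le_exp.2
  have h1 : D / L ≤ D := div_le_self hD0 hL
  have h2 : exp (-x) ≤ 1 := exp_le_one_iff.2 (by linarith)
  rw [sinh_eq]
  nlinarith [mul_le_mul_of_nonneg_left h2 hq]

/-- The estimate of a sum of values of `deKernel` that starts slightly to the left of its
maximum point `t`. -/
lemma mode_bound {q x t D L : ℝ} (hx : 0 < x) (hxt : x ≤ t)
    (hq : q * cosh t ^ 2 = sinh t) (hsx : cosh t ^ 2 ≤ 2 * sinh x ^ 2)
    (hD : D ≤ q / 2 * exp x) (hL : 1 ≤ L) (hxL : x ≤ L) :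
    (t - x) * deKernel q t + exp (-(q * sinh t)) ≤ exp (q / 2) * exp (-(D / L)) := by
  have hC := cosh_pos t
  have ht : 0 < t := hx.trans_le hxt
  have hS : 0 < sinh t := sinh_pos_iff.2 ht
  have hs : 0 < sinh x := sinh_pos_iff.2 hx
  -- With τ = tanh t, stationarity of the kernel at t gives q = τ / cosh t, q sinh t = τ² and
  -- maximum value τ exp(-τ²).
  set τ := sinh t / cosh t with hτ
  have hτ0 : 0 < τ := by positivity
  have hSτ : sinh t = τ * cosh t := by rw [hτ]; field_simp
  have hqτ : q = τ / cosh t := by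
    rw [eq_div_iff hC.ne', ← mul_left_inj' hC.ne', ← hSτ, ← hq]; ring
  have hq0 : 0 < q := by rw [hqτ]; positivity
  have hqS : q * sinh t = τ ^ 2 := by rw [hqτ, hSτ]; field_simp
  have hH : deKernel q t = τ * exp (-τ ^ 2) := by
    rw [deKernel, hqS, hqτ]; field_simp
  -- The hypothesis `hsx` gives sinh t ≤ √2 τ sinh x, so t - x ≤ (log 2)/2 + log τ, and log τ ≤ τ -
  -- 1.
  have hlog : t - x ≤ τ - 0.6534 := by
    have h1 : t - x ≤ log (√2 * τ) := by
      apply sub_le_log_of_sinh_le hx hxt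
      have h2 : cosh t ≤ √2 * sinh x := by
        apply le_of_sq_le_sq _ (by positivity)
        rw [mul_pow, sq_sqrt (by norm_num)]
        exact hsx
      have h3 : √2 * √2 = 2 := mul_self_sqrt (by norm_num)
      have h4 : (1 : ℝ) ≤ √2 := one_le_sqrt.2 (by norm_num)
      rw [hSτ]
      calc τ * cosh t ≤ τ * (√2 * sinh x) := by gcongr
        _ = √2 * τ * sinh x := by ring
    rw [log_mul (by positivity) hτ0.ne', log_sqrt (by norm_num)] at h1
    have h2 := log_le_sub_one_of_pos hτ0
    have h3 := half_log_two_le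
    norm_num at h1 h2 h3 ⊢
    linarith
  have hsum : (t - x) * deKernel q t + exp (-(q * sinh t)) ≤ exp (-τ ^ 2 + τ * (t - x)) := by
    rw [hH, hqS, exp_add]
    have h1 := add_one_le_exp (τ * (t - x))
    have h2 := exp_pos (-τ ^ 2)
    nlinarith [mul_le_mul_of_nonneg_left h1 h2.le]
  refine hsum.trans ?_
  rw [← exp_add]
  apply exp_le_exp.2
  have hm0 : 0 < max 1 t := lt_max_of_lt_left one_pos
  have hm1 : 0 < max 1 x := lt_max_of_lt_left one_pos
  have hL0 : 0 < L := by linarith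
  -- Here the division by L ≥ max(1, x) is essential: e^x / max(1, x) is nondecreasing, so x can be
  -- replaced by t.
  have hDL : D / L ≤ q / 2 * (0.6534 * exp t + 1) := by
    rw [div_le_iff₀ hL0]
    have h1 := exp_mul_max_le hxt
    have h2 := exp_le_max_mul (t := t)
    have h3 : exp x ≤ (0.6534 * exp t + 1) * max 1 x := by
      have h4 : exp x * max 1 t ≤ (0.6534 * exp t + 1) * max 1 x * max 1 t := by
        refine h1.trans ?_
        calc exp t * max 1 x ≤ max 1 t * (0.6534 * exp t + 1) * max 1 x := by gcongr
          _ = _ := by ring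
      exact le_of_mul_le_mul_right h4 hm0
    have h5 : max 1 x ≤ L := max_le hL hxL
    calc D ≤ q / 2 * exp x := hD
      _ ≤ q / 2 * ((0.6534 * exp t + 1) * L) := by
          have := exp_pos t
          gcongr
          exact h3.trans (by gcongr)
      _ = _ := by ring
  have hE : exp t ≤ 2 * cosh t := by
    rw [cosh_eq]; linarith [exp_pos (-t)]
  have hfin : q / 2 * (0.6534 * exp t + 1) ≤ 0.6534 * τ + q / 2 := by
    have : q / 2 * exp t ≤ τ := by
      calc q / 2 * exp t ≤ q / 2 * (2 * cosh t) := by gcongr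
        _ = τ := by rw [hqτ]; field_simp
    linarith
  nlinarith [mul_le_mul_of_nonneg_left hlog hτ0.le]

/-- The tail of the trapezoidal sum of `deKernel` beyond the threshold. -/
lemma sum_deKernel_tail_le {γ x D L h : ℝ} (hγ : 0 < γ) (hx : threshold (γ / 2) ≤ x)
    (hD0 : 0 ≤ D) (hD : D ≤ π * γ / 4 * exp x) (hL : 1 ≤ L) (hxL : x ≤ L) (hh : 0 < h) (m : ℕ) :
    ∑ k ∈ Finset.range m, h * deKernel (γ * (π / 2)) (x + (k + 1) * h) ≤
      exp (π * γ / 4) * exp (-(D / L)) := by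
  have hpi := pi_pos
  set q := γ * (π / 2) with hqdef
  have hq0 : 0 < q := by positivity
  have e1 : π * γ / 4 = q / 2 := by rw [hqdef]; ring
  have e2 : 2 * π * (γ / 2) = 2 * q := by rw [hqdef]; ring
  rw [e1] at hD ⊢
  -- If the kernel decreases from x on, the comparison is applied with the maximum point taken to be
  -- x itself.
  have hdecr : 0 ≤ x → (∀ y, x ≤ y → sinh y ≤ q * cosh y ^ 2) →
      ∑ k ∈ Finset.range m, h * deKernel q (x + (k + 1) * h) ≤
      exp (q / 2) * exp (-(D / L)) := by
    intro hx0 hy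
    refine (sum_deKernel_le hh hq0.le le_rfl ?_ (antitoneOn_deKernel hq0.le hy) m).trans ?_
    · rintro y ⟨h1, h2⟩
      rw [le_antisymm h2 h1]
    · rw [sub_self, zero_mul, zero_add]
      exact exp_neg_mul_sinh_le hD0 hD hL hx0 hq0.le
  rw [threshold, e2] at hx
  have hcond : γ / 2 < 1 / (2 * π) ↔ 2 * q < 1 := by
    rw [lt_div_iff₀ (by positivity), hqdef]
    constructor <;> intro h <;> linarith
  by_cases hc : 2 * q < 1
  · rw [if_pos (hcond.2 hc)] at hx
    set r := √(1 - (2 * q) ^ 2) with hr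
    have hr0 : 0 ≤ r := sqrt_nonneg _
    have hr2 : r ^ 2 = 1 - (2 * q) ^ 2 := sq_sqrt (by nlinarith)
    have hsx : √(1 + r) / (2 * q) ≤ sinh x := by
      have := sinh_le_sinh.2 hx
      rwa [sinh_arsinh] at this
    have hsx2 : 1 + r ≤ (2 * q * sinh x) ^ 2 := by
      rw [div_le_iff₀' (by positivity)] at hsx
      calc 1 + r = √(1 + r) ^ 2 := (sq_sqrt (by positivity)).symm
        _ ≤ _ := by gcongr
    have hs0 : 0 < sinh x := by
      refine lt_of_lt_of_le ?_ hsx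
      have : 0 < √(1 + r) := sqrt_pos.2 (by positivity)
      positivity
    have hx0 : 0 < x := sinh_pos_iff.1 hs0
    have hs1 : 1 ≤ sinh x := by
      by_contra hcon
      push Not at hcon
      have : 2 * q * sinh x < 1 := by nlinarith
      have h2 : 0 < 2 * q * sinh x := by positivity
      nlinarith
    -- The critical points solve q s² - s + q = 0 in s = sinh y. The roots are (1 ± r)/(2q), with
    -- product 1; the larger one gives the maximum, and the smaller is at most 1 ≤ sinh x.
    set t := arsinh ((1 + r) / (2 * q)) with ht
    have hst : sinh t = (1 + r) / (2 * q) := sinh_arsinh _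
    have hst' : 2 * q * sinh t = 1 + r := by rw [hst]; field_simp
    have hqt : q * cosh t ^ 2 = sinh t := by
      rw [cosh_sq, hst]
      field_simp
      nlinarith
    have hqs : ∀ y, sinh y - q * cosh y ^ 2 =
        -(q * ((sinh y - sinh t) * (sinh y - (1 - r) / (2 * q)))) := by
      intro y
      rw [cosh_sq, hst]
      field_simp
      nlinarith
    have hroot : (1 - r) / (2 * q) ≤ 1 := by
      rw [div_le_one (by positivity)]
      nlinarith
    have hanti : ∀ y, t ≤ y → 1 ≤ sinh y → sinh y ≤ q * cosh y ^ 2 := by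
      intro y hy h1
      have h2 : 0 ≤ (sinh y - sinh t) * (sinh y - (1 - r) / (2 * q)) :=
        mul_nonneg (sub_nonneg.2 (sinh_le_sinh.2 hy)) (by linarith)
      have h3 := hqs y
      have := mul_nonneg hq0.le h2
      linarith
    rcases le_total t x with htx | hxt
    · exact hdecr hx0.le fun y hy => hanti y (htx.trans hy) (hs1.trans (sinh_le_sinh.2 hy))
    · have hmono : MonotoneOn (deKernel q) (Set.Icc x t) := by
        refine monotoneOn_deKernel hq0.le fun y hy => ?_
        have h1 : 1 ≤ sinh y := hs1.trans (sinh_le_sinh.2 hy.1)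
        have h2 : 0 ≤ (sinh t - sinh y) * (sinh y - (1 - r) / (2 * q)) :=
          mul_nonneg (sub_nonneg.2 (sinh_le_sinh.2 hy.2)) (by linarith)
        have h3 := hqs y
        have := mul_nonneg hq0.le h2
        linarith
      refine (sum_deKernel_le hh hq0.le hxt (fun y hy => hmono hy (Set.right_mem_Icc.2 hxt) hy.2)
        (antitoneOn_deKernel hq0.le fun y hy => hanti y hy
          (hs1.trans (sinh_le_sinh.2 (hxt.trans hy)))) m).trans ?_
      refine mode_bound hx0 hxt hqt ?_ hD hL hxL
      -- The threshold is exactly the point where 2 sinh² x = cosh² t, because q² cosh² t = q sinh t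
      -- = (1 + r)/2.
      have h4 : q ^ 2 * cosh t ^ 2 ≤ q ^ 2 * (2 * sinh x ^ 2) := by
        have : q ^ 2 * cosh t ^ 2 = q * sinh t := by rw [← hqt]; ring
        nlinarith
      exact le_of_mul_le_mul_left h4 (by positivity)
  · rw [if_neg (fun h => hc (hcond.1 h))] at hx
    have hx0 : 0 ≤ x := (arsinh_nonneg_iff.2 zero_le_one).trans hx
    refine hdecr hx0 fun y _ => ?_
    rw [cosh_sq]
    push Not at hc
    -- For 2q ≥ 1 there is no increasing stretch: q(1 + s²) ≥ (1 + s²)/2 ≥ s.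
    nlinarith [sq_nonneg (sinh y - 1), sq_nonneg (sinh y)]

lemma threshold_pos {γ : ℝ} (hγ : 0 < γ) : 0 < threshold γ := by
  have hpi := pi_pos
  unfold threshold
  split_ifs with h
  · rw [arsinh_pos_iff]
    have : 0 < √(1 + √(1 - (2 * π * γ) ^ 2)) := sqrt_pos.2 (by positivity)
    positivity
  · exact arsinh_pos_iff.2 one_pos

/-! ### Integrability and decay of the kernel. -/

lemma tendsto_neg_exp_neg_mul_sinh {q : ℝ} (hq : 0 < q) :
    Tendsto (fun x => -exp (-(q * sinh x))) atTop (𝓝 0) := by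
  have h1 : Tendsto sinh atTop atTop :=
    tendsto_atTop_mono' _ ((eventually_ge_atTop 0).mono fun x hx => self_le_sinh_iff.2 hx)
      tendsto_id
  have h2 := (tendsto_exp_neg_atTop_nhds_zero.comp (h1.const_mul_atTop hq)).neg
  simpa using h2

lemma integrableOn_deKernel {q : ℝ} (hq : 0 < q) : IntegrableOn (deKernel q) (Set.Ioi 0) :=
  integrableOn_Ioi_deriv_of_nonneg' (fun x _ => hasDerivAt_neg_exp_neg_mul_sinh q x)
    (fun x _ => deKernel_nonneg hq.le x) (tendsto_neg_exp_neg_mul_sinh hq)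

lemma integral_deKernel {q : ℝ} (hq : 0 < q) : ∫ x in Set.Ioi 0, deKernel q x = 1 := by
  rw [integral_Ioi_of_hasDerivAt_of_nonneg' (fun x _ => hasDerivAt_neg_exp_neg_mul_sinh q x)
    (fun x _ => deKernel_nonneg hq.le x) (tendsto_neg_exp_neg_mul_sinh hq)]
  simp

lemma integrable_deKernel_abs {q : ℝ} (hq : 0 < q) : Integrable fun x => deKernel q |x| := by
  -- A non-integrable function has integral 0 by convention, whereas this integral is 2.
  apply Integrable.of_integral_ne_zero
  rw [integral_comp_abs, integral_deKernel hq]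
  norm_num

lemma deKernel_abs_isBigO {q : ℝ} (hq : 0 < q) :
    (fun x => deKernel q |x|) =O[cocompact ℝ] fun x => |x| ^ (-2 : ℝ) := by
  refine IsBigO.of_bound (12 / q ^ 2) ?_
  filter_upwards [(tendsto_norm_cocompact_atTop (E := ℝ)).eventually_ge_atTop 1] with x hx
  rw [norm_eq_abs] at hx
  have hs : |x| ≤ sinh |x| := self_le_sinh_iff.2 (abs_nonneg x)
  have hs0 : 0 < sinh |x| := by linarith
  have hx0 : 0 < |x| := by linarith
  have hc : cosh |x| ≤ 2 * sinh |x| := by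
    apply le_of_sq_le_sq _ (by positivity)
    rw [cosh_sq]
    nlinarith
  rw [norm_of_nonneg (deKernel_nonneg hq.le _), norm_of_nonneg (by positivity),
    rpow_neg (abs_nonneg x), show (2 : ℝ) = ((2 : ℕ) : ℝ) by norm_num, rpow_natCast, deKernel,
    exp_neg]
  -- The cubic term of exp absorbs cosh ≤ 2 sinh and leaves inverse square decay.
  have he := pow_div_factorial_le_exp (q * sinh |x|) (by positivity) 3
  have h6 : ((Nat.factorial 3 : ℕ) : ℝ) = 6 := by norm_num [Nat.factorial]
  rw [h6] at he
  calc q * cosh |x| * (exp (q * sinh |x|))⁻¹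
      ≤ q * (2 * sinh |x|) * ((q * sinh |x|) ^ 3 / 6)⁻¹ := by
        have := cosh_pos |x|
        gcongr
    _ = 12 / q ^ 2 * (sinh |x| ^ 2)⁻¹ := by field_simp; norm_num
    _ ≤ _ := by gcongr

/-! ### Change of variables on the real line. -/

/-- The real restriction of the double-exponential map. -/
def deMapReal (x : ℝ) : ℝ := sinh (π / 2 * sinh x)

lemma deMap_ofReal (x : ℝ) : deMap x = deMapReal x := by
  simp [deMap, deMapReal]

lemma deriv_deMap_ofReal (x : ℝ) :
    deriv deMap x = ((π / 2 * cosh x * cosh (π / 2 * sinh x) : ℝ) : ℂ) := by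
  rw [deriv_deMap]
  simp

lemma hasDerivAt_deMapReal (x : ℝ) :
    HasDerivAt deMapReal (π / 2 * cosh x * cosh (π / 2 * sinh x)) x := by
  have h := ((hasDerivAt_sinh x).const_mul (π / 2)).sinh
  refine h.congr_deriv ?_
  ring

lemma deMapReal_injective : Function.Injective deMapReal := by
  intro x y h
  have h1 := sinh_injective h
  have hpi : π / 2 ≠ 0 := by positivity
  exact sinh_injective (mul_left_cancel₀ hpi h1)

lemma deMapReal_surjective : Function.Surjective deMapReal := by
  intro t
  refine ⟨arsinh (2 / π * arsinh t), ?_⟩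
  have hpi := pi_pos
  rw [deMapReal, sinh_arsinh, ← mul_assoc, show π / 2 * (2 / π) = 1 by field_simp, one_mul,
    sinh_arsinh]

lemma abs_deriv_smul_eq_transformed (f : ℂ → ℂ) (x : ℝ) :
    |π / 2 * cosh x * cosh (π / 2 * sinh x)| • f (deMapReal x : ℝ) = transformed f x := by
  have hpi := pi_pos
  have h1 := cosh_pos x
  have h2 := cosh_pos (π / 2 * sinh x)
  rw [transformed, deMap_ofReal, deriv_deMap_ofReal, abs_of_pos (by positivity), Complex.real_smul,
    mul_comm]

lemma integral_transformed (f : ℂ → ℂ) : ∫ x : ℝ, transformed f x = ∫ t : ℝ, f t := by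
  have h := integral_image_eq_integral_abs_deriv_smul MeasurableSet.univ
    (fun x _ => (hasDerivAt_deMapReal x).hasDerivWithinAt) deMapReal_injective.injOn
    (fun t : ℝ => f t)
  rw [Set.image_univ, deMapReal_surjective.range_eq, setIntegral_univ, setIntegral_univ] at h
  simp_rw [abs_deriv_smul_eq_transformed] at h
  exact h.symm

lemma integrable_transformed_iff (f : ℂ → ℂ) :
    Integrable (fun x : ℝ => transformed f x) ↔ Integrable fun t : ℝ => f t := by
  have h := integrableOn_image_iff_integrableOn_abs_deriv_smul MeasurableSet.univ
    (fun x _ => (hasDerivAt_deMapReal x).hasDerivWithinAt) deMapReal_injective.injOn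
    (fun t : ℝ => f t)
  rw [Set.image_univ, deMapReal_surjective.range_eq, integrableOn_univ, integrableOn_univ] at h
  simp_rw [abs_deriv_smul_eq_transformed] at h
  exact h.symm

lemma differentiableOn_transformed {f : ℂ → ℂ} {d : ℝ}
    (hf : AnalyticOnNhd ℂ f (deMap '' strip d)) : DifferentiableOn ℂ (transformed f) (strip d) := by
  intro z hz
  have h1 : DifferentiableAt ℂ f (deMap z) := (hf _ ⟨z, hz, rfl⟩).differentiableAt
  have h2 : deriv deMap = fun z => (π / 2 : ℂ) * Complex.cosh z *
      Complex.cosh ((π / 2 : ℂ) * Complex.sinh z) := funext deriv_deMap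
  unfold transformed
  rw [h2]
  refine DifferentiableAt.differentiableWithinAt ?_
  refine (h1.comp z (hasDerivAt_deMap z).differentiableAt).mul ?_
  fun_prop

/-! ### Bounds on horizontal lines and the discretization error. -/

/-- The factor in the bound of the transformed integrand on the line of height `y`. -/
def lineConst (K γ ν y : ℝ) : ℝ := K * 2 ^ ν / γ / (cos (π / 2 * sin y) ^ ν * cos y)

section Bounds

variable {f : ℂ → ℂ} {K α β d : ℝ}

lemma norm_transformed_le_of_nonneg (hK : 0 < K) (hβ : 0 < β) (hd : d < π / 2)
    (hpos : ∀ z ∈ deMap '' stripPos d, ‖f z‖ ≤ K * ‖E₁ z β‖) {x y : ℝ} (hy : |y| < d)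
    (hx : 0 ≤ x) :
    ‖transformed f (x + y * Complex.I)‖ ≤
      lineConst K β β y * deKernel (β * (π / 2) * cos y) |x| :=
  norm_transformed_le hK hβ (hy.trans hd)
    (hpos _ ⟨_, ⟨by simpa [strip] using hy, by simpa using hx⟩, rfl⟩)

lemma norm_transformed_le_of_neg (hK : 0 < K) (hα : 0 < α) (hd : d < π / 2)
    (hneg : ∀ z ∈ deMap '' stripNeg d, ‖f z‖ ≤ K * ‖E₁ z α‖) {x y : ℝ} (hy : |y| < d)
    (hx : x < 0) :
    ‖transformed f (x + y * Complex.I)‖ ≤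
      lineConst K α α y * deKernel (α * (π / 2) * cos y) |x| :=
  norm_transformed_le hK hα (hy.trans hd)
    (hneg _ ⟨_, ⟨by simpa [strip] using hy, by simpa using hx⟩, rfl⟩)

lemma cos_pos_of_abs_lt {y : ℝ} (hy : |y| < π / 2) : 0 < cos y :=
  cos_pos_of_mem_Ioo ⟨by linarith [(abs_lt.1 hy).1], (abs_lt.1 hy).2⟩

lemma lineConst_le {γ μ ν y : ℝ} (hK : 0 < K) (hμ : 0 < μ) (hμγ : μ ≤ γ) (hγν : γ ≤ ν)
    (hy : |y| < π / 2) : lineConst K γ γ y ≤ lineConst K μ ν y := by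
  have h1 := cos_half_pi_sin_pos hy
  have h2 := cos_pos_of_abs_lt hy
  have h3 : cos (π / 2 * sin y) ^ ν ≤ cos (π / 2 * sin y) ^ γ :=
    rpow_le_rpow_of_exponent_ge h1 (cos_le_one _) hγν
  have h4 : (2 : ℝ) ^ γ ≤ 2 ^ ν := rpow_le_rpow_of_exponent_le (by norm_num) hγν
  unfold lineConst
  gcongr

lemma lineConst_pos {γ ν y : ℝ} (hK : 0 < K) (hγ : 0 < γ) (hy : |y| < π / 2) :
    0 < lineConst K γ ν y := by
  have h1 := cos_half_pi_sin_pos hy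
  have h2 := cos_pos_of_abs_lt hy
  unfold lineConst
  positivity

/-- Enlarging the exponential rate and the factor, in the form needed for uniformity in `y`. -/
lemma lineConst_mul_deKernel_le {γ μ ν y c x : ℝ} (hK : 0 < K) (hμ : 0 < μ) (hμγ : μ ≤ γ)
    (hγν : γ ≤ ν) (hyc : |y| ≤ c) (hc : c < π / 2) :
    lineConst K γ γ y * deKernel (γ * (π / 2) * cos y) |x| ≤
      lineConst K μ ν c * deKernel (μ * (π / 2) * cos c) |x| := by
  have hpi := pi_pos
  have hy : |y| < π / 2 := hyc.trans_lt hc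
  have hc0 : 0 ≤ c := (abs_nonneg y).trans hyc
  have hc' : |c| < π / 2 := by rwa [abs_of_nonneg hc0]
  have hcy : cos c ≤ cos y := by
    rw [← cos_abs y]
    exact cos_le_cos_of_nonneg_of_le_pi (abs_nonneg y) (by linarith) hyc
  have h0 := cos_pos_of_abs_lt hc'
  have h1 := cos_half_pi_sin_pos hc'
  have h1y := cos_half_pi_sin_pos hy
  have h2 : cos (π / 2 * sin c) ≤ cos (π / 2 * sin y) := by
    have hsy : |sin y| ≤ sin c := by
      rw [abs_le]
      rw [abs_le] at hyc
      rw [← sin_neg]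
      exact ⟨sin_le_sin_of_le_of_le_pi_div_two (by linarith) (by linarith [abs_lt.1 hy]) hyc.1,
        sin_le_sin_of_le_of_le_pi_div_two (by linarith) (by linarith) hyc.2⟩
    rw [← cos_abs (π / 2 * sin y), abs_mul, abs_of_pos (by positivity : 0 < π / 2)]
    refine cos_le_cos_of_nonneg_of_le_pi (by positivity) ?_ (by gcongr)
    nlinarith [sin_le_one c]
  have hγ : 0 < γ := hμ.trans_le hμγ
  have h3 : cos (π / 2 * sin c) ^ ν ≤ cos (π / 2 * sin y) ^ γ :=
    (rpow_le_rpow_of_exponent_ge h1 (cos_le_one _) hγν).trans (rpow_le_rpow h1.le h2 hγ.le)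
  have h4 : (2 : ℝ) ^ γ ≤ 2 ^ ν := rpow_le_rpow_of_exponent_le (by norm_num) hγν
  have h5 := cosh_pos |x|
  have h6 : 0 ≤ sinh |x| := sinh_nonneg_iff.2 (abs_nonneg x)
  have hcy0 := h0.trans_le hcy
  -- In the product the factors γ cos y cancel, so what remains is monotone in each parameter.
  have e : ∀ γ ν y, γ ≠ 0 → cos y ≠ 0 → lineConst K γ ν y * deKernel (γ * (π / 2) * cos y) |x| =
      K * 2 ^ ν / cos (π / 2 * sin y) ^ ν * (π / 2) * cosh |x| *
        exp (-(γ * (π / 2) * cos y * sinh |x|)) := by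
    intro γ ν y h h'
    unfold lineConst deKernel
    field_simp
  rw [e γ γ y hγ.ne' hcy0.ne', e μ ν c hμ.ne' h0.ne']
  gcongr

lemma norm_transformed_le_uniform (hK : 0 < K) (hα : 0 < α) (hβ : 0 < β) (hd : d < π / 2)
    (hneg : ∀ z ∈ deMap '' stripNeg d, ‖f z‖ ≤ K * ‖E₁ z α‖)
    (hpos : ∀ z ∈ deMap '' stripPos d, ‖f z‖ ≤ K * ‖E₁ z β‖)
    {c : ℝ} (hc : c < d) (x y : ℝ) (hy : |y| ≤ c) :
    ‖transformed f (x + y * Complex.I)‖ ≤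
      lineConst K (min α β) (max α β) c * deKernel (min α β * (π / 2) * cos c) |x| := by
  have hμ : 0 < min α β := lt_min hα hβ
  rcases lt_or_ge x 0 with hx | hx
  · exact (norm_transformed_le_of_neg hK hα hd hneg (hy.trans_lt hc) hx).trans
      (lineConst_mul_deKernel_le hK hμ (min_le_left _ _) (le_max_left _ _) hy (hc.trans hd))
  · exact (norm_transformed_le_of_nonneg hK hβ hd hpos (hy.trans_lt hc) hx).trans
      (lineConst_mul_deKernel_le hK hμ (min_le_right _ _) (le_max_right _ _) hy (hc.trans hd))

lemma integral_norm_transformed_le (hK : 0 < K) (hα : 0 < α) (hβ : 0 < β) (hd : d < π / 2)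
    (hneg : ∀ z ∈ deMap '' stripNeg d, ‖f z‖ ≤ K * ‖E₁ z α‖)
    (hpos : ∀ z ∈ deMap '' stripPos d, ‖f z‖ ≤ K * ‖E₁ z β‖)
    {y : ℝ} (hy : |y| < d) :
    ∫ x : ℝ, ‖transformed f (x + y * Complex.I)‖ ≤
      2 * lineConst K (min α β) (max α β) y := by
  have hμ : 0 < min α β := lt_min hα hβ
  have hy' := hy.trans hd
  have hpi := pi_pos
  have hcy := cos_pos_of_abs_lt hy'
  -- Without integrability the integral is 0 and the bound is trivial.
  by_cases hint : Integrable fun x : ℝ => ‖transformed f (x + y * Complex.I)‖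
  swap
  · rw [integral_undef hint]
    have := lineConst_pos (ν := max α β) hK hμ hy'
    positivity
  have hqα : 0 < α * (π / 2) * cos y := by positivity
  have hqβ : 0 < β * (π / 2) * cos y := by positivity
  have h1 : ∫ x in Set.Iic (0 : ℝ), ‖transformed f (x + y * Complex.I)‖ ≤
      lineConst K α α y := by
    rw [← neg_zero, ← integral_comp_neg_Ioi (0 : ℝ)
      (fun x : ℝ => ‖transformed f (x + y * Complex.I)‖), ← mul_one (lineConst K α α y),
      ← integral_deKernel hqα, ← integral_const_mul]
    refine setIntegral_mono_on ?_ ((integrableOn_deKernel hqα).const_mul _) measurableSet_Ioi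
      fun x hx => ?_
    · exact hint.comp_neg.integrableOn
    · have := norm_transformed_le_of_neg hK hα hd hneg hy (x := -x) (by simpa using hx)
      rwa [abs_neg, abs_of_pos hx] at this
  have h2 : ∫ x in Set.Ioi (0 : ℝ), ‖transformed f (x + y * Complex.I)‖ ≤
      lineConst K β β y := by
    rw [← mul_one (lineConst K β β y), ← integral_deKernel hqβ, ← integral_const_mul]
    refine setIntegral_mono_on hint.integrableOn ((integrableOn_deKernel hqβ).const_mul _)
      measurableSet_Ioi fun x hx => ?_
    have := norm_transformed_le_of_nonneg hK hβ hd hpos hy (x := x) (le_of_lt hx)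
    rwa [abs_of_pos hx] at this
  rw [← intervalIntegral.integral_Iic_add_Ioi (b := (0 : ℝ)) hint.integrableOn hint.integrableOn]
  have h3 := lineConst_le hK hμ (min_le_left α β) (le_max_left α β) hy'
  have h4 := lineConst_le hK hμ (min_le_right α β) (le_max_right α β) hy'
  linarith

/-- Analyticity and the uniform majorant are available only on closed substrips |Im ζ| ≤ c with c <
d. The estimate is proved for each c and then c → d, which is harmless since the bound is continuous
at d. -/
lemma integrable_and_summable_and_trapezoidal_le (hK : 0 < K) (hα : 0 < α) (hβ : 0 < β) (hd : d < π / 2)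
    (hneg : ∀ z ∈ deMap '' stripNeg d, ‖f z‖ ≤ K * ‖E₁ z α‖)
    (hpos : ∀ z ∈ deMap '' stripPos d, ‖f z‖ ≤ K * ‖E₁ z β‖)
    (hd0 : 0 < d)
    (hf : AnalyticOnNhd ℂ f (deMap '' strip d)) {h : ℝ} (hh : 0 < h) :
    Integrable (fun x : ℝ => transformed f x) ∧
    Summable (fun k : ℤ => transformed f ((k : ℝ) * h : ℝ)) ∧
    ‖(∫ x : ℝ, transformed f x) - h * ∑' k : ℤ, transformed f ((k : ℝ) * h : ℝ)‖ ≤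
      2 * (2 * lineConst K (min α β) (max α β) d) *
        (exp (-(2 * π * d / h)) / (1 - exp (-(2 * π * d / h)))) := by
  have hpi := pi_pos
  have hμ : 0 < min α β := lt_min hα hβ
  have hF := differentiableOn_transformed hf
  have key : ∀ c, 0 < c → c < d →
      Integrable (fun x : ℝ => transformed f x) ∧
      Summable (fun k : ℤ => transformed f ((k : ℝ) * h : ℝ)) ∧
      ‖(∫ x : ℝ, transformed f x) - h * ∑' k : ℤ, transformed f ((k : ℝ) * h : ℝ)‖ ≤
      2 * (2 * lineConst K (min α β) (max α β) c) *
        (exp (-(2 * π * c / h)) / (1 - exp (-(2 * π * c / h)))) := by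
    intro c hc0 hcd
    have hcc : 0 < cos c := cos_pos_of_abs_lt (by rw [abs_of_pos hc0]; linarith)
    have hq : 0 < min α β * (π / 2) * cos c := by positivity
    have hsub : {z : ℂ | |z.im| ≤ c} ⊆ strip d := fun z hz => lt_of_le_of_lt hz hcd
    have hb := norm_transformed_le_uniform hK hα hβ hd hneg hpos hcd
    have hgi := (integrable_deKernel_abs hq).const_mul (lineConst K (min α β) (max α β) c)
    refine ⟨?_, norm_integral_sub_tsum_le hc0 hh (hF.mono hsub) hb hgi
      ((deKernel_abs_isBigO hq).const_mul_left _) fun y hy => ?_⟩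
    · refine hgi.mono' (Continuous.aestronglyMeasurable ?_) (Eventually.of_forall fun x => ?_)
      · exact hF.continuousOn.comp_continuous (by fun_prop) fun x => by simpa [strip] using hd0
      · simpa using hb x 0 (by simpa using hc0.le)
    · refine (integral_norm_transformed_le hK hα hβ hd hneg hpos (hy.trans_lt hcd)).trans
        (le_of_eq ?_)
      rw [← hy, lineConst, lineConst]
      rcases abs_choice y with h | h
      · rw [h]
      · simp [h]
  have hhalf := key (d / 2) (by linarith) (by linarith)
  refine ⟨hhalf.1, hhalf.2.1, ?_⟩
  have hdabs : |d| < π / 2 := by rwa [abs_of_pos hd0]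
  have hcos := cos_half_pi_sin_pos hdabs
  have hcosd := cos_pos_of_abs_lt hdabs
  have hexp : exp (-(2 * π * d / h)) < 1 := by
    rw [exp_lt_one_iff, neg_lt_zero]
    positivity
  have hlim : Tendsto (fun c => 2 * (2 * lineConst K (min α β) (max α β) c) *
        (exp (-(2 * π * c / h)) / (1 - exp (-(2 * π * c / h))))) (𝓝[<] d)
      (𝓝 (2 * (2 * lineConst K (min α β) (max α β) d) *
        (exp (-(2 * π * d / h)) / (1 - exp (-(2 * π * d / h)))))) := by
    refine Tendsto.mono_left (ContinuousAt.tendsto ?_) nhdsWithin_le_nhds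
    unfold lineConst
    have h1 : 1 - exp (-(2 * π * d / h)) ≠ 0 := by linarith
    have h2 : cos (π / 2 * sin d) ^ (max α β) * cos d ≠ 0 := by positivity
    have h3 : cos (π / 2 * sin d) ≠ 0 ∨ 0 ≤ max α β := Or.inl hcos.ne'
    fun_prop (disch := assumption)
  refine ge_of_tendsto hlim ?_
  filter_upwards [Ioo_mem_nhdsLT hd0] with c hc
  exact (key c hc.1 hc.2).2.2

end Bounds

/-! ### Truncation of the sum and the choice of M and N. -/

lemma sum_Icc_neg_add (u : ℤ → ℂ) {M N : ℤ} (hM : 0 ≤ M) (hN : 0 ≤ N) (m : ℕ) :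
    ∑ k ∈ Finset.Icc (-(M + m)) (N + m), u k = ∑ k ∈ Finset.Icc (-M) N, u k +
      (∑ j ∈ Finset.range m, u (N + (j + 1)) + ∑ j ∈ Finset.range m, u (-(M + (j + 1)))) := by
  induction m with
  | zero => simp
  | succ m ih =>
    have h1 : Finset.Icc (-(M + (m + 1 : ℕ))) (N + (m + 1 : ℕ)) =
        insert (N + (m + 1 : ℕ)) (insert (-(M + (m + 1 : ℕ)))
          (Finset.Icc (-(M + m)) (N + m))) := by
      ext k
      simp only [Finset.mem_Icc, Finset.mem_insert]
      push_cast
      omega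
    rw [h1, Finset.sum_insert, Finset.sum_insert, ih, Finset.sum_range_succ, Finset.sum_range_succ]
    · push_cast
      ring
    · simp only [Finset.mem_Icc]
      push_cast
      omega
    · simp only [Finset.mem_Icc, Finset.mem_insert]
      push_cast
      omega

lemma norm_tsum_sub_sum_Icc_le {u : ℤ → ℂ} (hu : Summable u) {M N : ℤ} (hM : 0 ≤ M) (hN : 0 ≤ N)
    {A B : ℝ} (hA : ∀ m : ℕ, ∑ j ∈ Finset.range m, ‖u (-(M + (j + 1)))‖ ≤ A)
    (hB : ∀ m : ℕ, ∑ j ∈ Finset.range m, ‖u (N + (j + 1))‖ ≤ B) :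
    ‖∑' k, u k - ∑ k ∈ Finset.Icc (-M) N, u k‖ ≤ A + B := by
  have hI : Tendsto (fun m : ℕ => Finset.Icc (-(M + m)) (N + m)) atTop atTop := by
    refine tendsto_atTop_finset_of_monotone (fun a b hab => ?_) fun k => ⟨k.natAbs, ?_⟩
    · refine Finset.Icc_subset_Icc ?_ ?_ <;> omega
    · rw [Finset.mem_Icc]
      omega
  have hlim := ((hu.hasSum.comp hI).sub_const (∑ k ∈ Finset.Icc (-M) N, u k)).norm
  refine le_of_tendsto hlim (Eventually.of_forall fun m => ?_)
  simp only [Function.comp]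
  rw [sum_Icc_neg_add u hM hN m, add_sub_cancel_left, add_comm A B]
  exact (norm_add_le _ _).trans (add_le_add ((norm_sum_le _ _).trans (hB m))
    ((norm_sum_le _ _).trans (hA m)))

lemma rightLimit_eq_leftLimit (α β h : ℝ) (n : ℕ) : rightLimit α β h n = leftLimit β α h n := by
  rw [rightLimit, leftLimit, min_comm]

/-- The truncation limit is at most `n`, and large enough for the tail on its side. -/
lemma leftLimit_bounds {α β d h : ℝ} (hα : 0 < α) (hβ : 0 < β) (hd : 0 < d) {n : ℕ} (hn : 0 < n)
    (hh : 0 < h) (hnh : n * h = log (8 * d * n / min α β)) :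
    (leftLimit α β h n : ℝ) * h ≤ log (8 * d * n / min α β) ∧
      8 * d * n ≤ α * exp (leftLimit α β h n * h) := by
  have hn' : (0 : ℝ) < n := by exact_mod_cast hn
  rw [← hnh]
  by_cases hmin : min α β = α
  · rw [leftLimit, if_pos hmin]
    refine ⟨by simp, ?_⟩
    rw [Int.cast_natCast, hnh, hmin, exp_log (by positivity)]
    field_simp
    exact le_rfl
  · rw [leftLimit, if_neg hmin]
    have hβα : β < α := by
      by_contra hcon
      exact hmin (min_eq_left (not_lt.1 hcon))
    rw [min_eq_right hβα.le] at hnh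
    have hlog : 0 ≤ log (α / β) := log_nonneg ((one_le_div hβ).2 hβα.le)
    have hfl0 : (0 : ℝ) ≤ (⌊log (α / β) / h⌋ : ℝ) := by
      exact_mod_cast Int.floor_nonneg.2 (div_nonneg hlog hh.le)
    have hfl : (⌊log (α / β) / h⌋ : ℝ) * h ≤ log (α / β) := by
      rw [← le_div_iff₀ hh]
      exact Int.floor_le _
    push_cast
    refine ⟨by nlinarith, ?_⟩
    -- Rounding down keeps Mh at least log(8dn/β) - log(α/β) = log(8dn/α).
    have h1 : log (8 * d * n / β) - log (α / β) ≤ (n - (⌊log (α / β) / h⌋ : ℝ)) * h := by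
      rw [← hnh]; linarith
    have h2 := exp_le_exp.2 h1
    rw [exp_sub, exp_log (by positivity), exp_log (by positivity)] at h2
    calc 8 * d * n = α * (8 * d * n / β / (α / β)) := by field_simp
      _ ≤ _ := by gcongr

lemma exp_one_mul_log_le {q : ℝ} (hq : 0 < q) : exp 1 * log q ≤ q := by
  have h := log_le_sub_one_of_pos (div_pos hq (exp_pos 1))
  rw [log_div hq.ne' (exp_pos 1).ne', log_exp] at h
  have h2 : log q ≤ q / exp 1 := by linarith
  rwa [le_div_iff₀' (exp_pos 1)] at h2

lemma sum_tail_le {u : ℕ → ℂ} {K γ μ ν x D L h : ℝ} (hK : 0 < K) (hμ : 0 < μ) (hμγ : μ ≤ γ)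
    (hγν : γ ≤ ν) (hx : threshold (γ / 2) ≤ x) (hD0 : 0 ≤ D) (hD : D ≤ π * γ / 4 * exp x)
    (hL : 1 ≤ L) (hxL : x ≤ L) (hh : 0 < h)
    (hu : ∀ j : ℕ, ‖u j‖ ≤ lineConst K γ γ 0 * deKernel (γ * (π / 2)) (x + (j + 1) * h)) (m : ℕ) :
    ∑ j ∈ Finset.range m, ‖u j‖ ≤
      h⁻¹ * (lineConst K μ ν 0 * (exp (π * ν / 4) * exp (-(D / L)))) := by
  have hpi := pi_pos
  have h0 : |(0 : ℝ)| < π / 2 := by rw [abs_zero]; positivity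
  have hγ : 0 < γ := hμ.trans_le hμγ
  have h1 := lineConst_le hK hμ hμγ hγν h0
  have h2 := lineConst_pos (ν := γ) hK hγ h0
  have h2' := h2.trans_le h1
  have h3 := sum_deKernel_tail_le hγ hx hD0 hD hL hxL hh m
  rw [← Finset.mul_sum] at h3
  have h4 : exp (π * γ / 4) ≤ exp (π * ν / 4) := exp_le_exp.2 (by gcongr)
  calc ∑ j ∈ Finset.range m, ‖u j‖
      ≤ ∑ j ∈ Finset.range m, lineConst K γ γ 0 * deKernel (γ * (π / 2)) (x + (j + 1) * h) :=
        Finset.sum_le_sum fun j _ => hu j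
    _ = h⁻¹ * (lineConst K γ γ 0 *
        (h * ∑ j ∈ Finset.range m, deKernel (γ * (π / 2)) (x + (j + 1) * h))) := by
        rw [← Finset.mul_sum, mul_left_comm _ h, inv_mul_cancel_left₀ hh.ne']
    _ ≤ h⁻¹ * (lineConst K γ γ 0 * (exp (π * γ / 4) * exp (-(D / L)))) := by gcongr
    _ ≤ _ := by gcongr

lemma deQuadrature_eq (f : ℂ → ℂ) (h : ℝ) (M N : ℤ) : deQuadrature f h M N =
    h * ∑ k ∈ Finset.Icc (-M) N, transformed f ((k : ℝ) * h : ℝ) := rfl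

end SincQuad

end

/-! ### Combination of the two error estimates. -/

theorem theorem2p9
    (d : ℝ) (hd : 0 < d) (hd' : d < Real.pi / 2)
    (f : ℂ → ℂ) (hf : AnalyticOnNhd ℂ f (SincQuad.deMap '' SincQuad.strip d))
    (K α β : ℝ) (hK : 0 < K) (hα : 0 < α) (hβ : 0 < β)
    (hneg : ∀ z ∈ SincQuad.deMap '' SincQuad.stripNeg d, ‖f z‖ ≤ K * ‖SincQuad.E₁ z α‖)
    (hpos : ∀ z ∈ SincQuad.deMap '' SincQuad.stripPos d, ‖f z‖ ≤ K * ‖SincQuad.E₁ z β‖)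
    (μ ν : ℝ) (hμ : μ = min α β) (hν : ν = max α β)
    (n : ℕ) (h : ℝ) (hh : h = SincQuad.stepSize d μ n)
    (M N : ℤ) (hM : M = SincQuad.leftLimit α β h n) (hN : N = SincQuad.rightLimit α β h n)
    (hn : ν * Real.exp 1 / (8 * d) ≤ n)
    (hMh : SincQuad.threshold (α / 2) ≤ M * h)
    (hNh : SincQuad.threshold (β / 2) ≤ N * h) :
    MeasureTheory.Integrable (fun t : ℝ => f (t : ℂ)) ∧
      ‖(∫ t : ℝ, f (t : ℂ)) - SincQuad.deQuadrature f h M N‖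
        ≤ SincQuad.C₁ K μ ν d
            * Real.exp (-(2 * Real.pi * d * n) / Real.log (8 * d * n / μ)) := by
  open Real SincQuad in
  have hpi := pi_pos
  have he := exp_pos 1
  have hμ0 : 0 < μ := hμ ▸ lt_min hα hβ
  have hμα : μ ≤ α := hμ ▸ min_le_left _ _
  have hμβ : μ ≤ β := hμ ▸ min_le_right _ _
  have hαν : α ≤ ν := hν ▸ le_max_left _ _
  have hβν : β ≤ ν := hν ▸ le_max_right _ _
  have hν0 : 0 < ν := hα.trans_le hαν
  have hn0 : (0 : ℝ) < n := lt_of_lt_of_le (by positivity) hn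
  have hn0' : 0 < n := by exact_mod_cast hn0
  set q := 8 * d * n / μ with hq
  have hqe : exp 1 ≤ q := by
    rw [hq, le_div_iff₀ hμ0]
    rw [div_le_iff₀' (by positivity)] at hn
    nlinarith
  have hq0 : 0 < q := he.trans_le hqe
  set L := log q with hLdef
  have hL1 : 1 ≤ L := (le_log_iff_exp_le hq0).2 hqe
  have hL0 : 0 < L := by linarith
  have hnh : n * h = L := by rw [hh, stepSize, mul_div_cancel₀ _ hn0.ne']
  have hh0 : 0 < h := by
    rw [hh, stepSize]
    exact div_pos hL0 hn0
  have hb1 := leftLimit_bounds hα hβ hd hn0' hh0 (by rw [← hμ]; exact hnh)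
  have hb2 := leftLimit_bounds hβ hα hd hn0' hh0 (by rw [min_comm, ← hμ]; exact hnh)
  rw [← hM, ← hμ] at hb1
  rw [← rightLimit_eq_leftLimit, ← hN, min_comm, ← hμ] at hb2
  have hMpos : 0 < M * h := (threshold_pos (by positivity)).trans_le hMh
  have hNpos : 0 < N * h := (threshold_pos (by positivity)).trans_le hNh
  have hM0 : 0 ≤ M := by
    have := (pos_iff_pos_of_mul_pos hMpos).2 hh0
    exact_mod_cast this.le
  have hN0 : 0 ≤ N := by
    have := (pos_iff_pos_of_mul_pos hNpos).2 hh0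
    exact_mod_cast this.le
  obtain ⟨hint, hsum, htrap⟩ :=
    integrable_and_summable_and_trapezoidal_le hK hα hβ hd' hneg hpos hd hf hh0
  rw [← hμ, ← hν, integral_transformed] at htrap
  refine ⟨(integrable_transformed_iff f).1 hint, ?_⟩
  set D := 2 * π * d * n with hD
  have hD0 : 0 ≤ D := by positivity
  have hDh : 2 * π * d / h = D / L := by
    rw [← hnh, hD]; field_simp
  -- D is π/4 times 8dn, and 8dn ≤ α e^{Mh}.
  have hDα : D ≤ π * α / 4 * exp (M * h) := by
    have := mul_le_mul_of_nonneg_left hb1.2 hpi.le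
    linarith
  have hDβ : D ≤ π * β / 4 * exp (N * h) := by
    have := mul_le_mul_of_nonneg_left hb2.2 hpi.le
    linarith
  set u : ℤ → ℂ := fun k => transformed f ((k : ℝ) * h : ℝ) with hu
  have hA := sum_tail_le (u := fun j : ℕ => u (-(M + (j + 1)))) hK hμ0 hμα hαν hMh hD0 hDα hL1
    hb1.1 hh0 (fun j => by
      have h1 : 0 < M * h + (j + 1) * h := by positivity
      have h2 := norm_transformed_le_of_neg hK hα hd' hneg (x := -(M * h + (j + 1) * h)) (y := 0)
        (by simpa using hd) (by linarith)
      rw [abs_neg, abs_of_pos h1, cos_zero, mul_one] at h2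
      convert h2 using 2
      simp only [hu]
      congr 1
      push_cast
      ring)
  have hB := sum_tail_le (u := fun j : ℕ => u (N + (j + 1))) hK hμ0 hμβ hβν hNh hD0 hDβ hL1
    hb2.1 hh0 (fun j => by
      have h1 : 0 < N * h + (j + 1) * h := by positivity
      have h2 := norm_transformed_le_of_nonneg hK hβ hd' hpos (x := N * h + (j + 1) * h) (y := 0)
        (by simpa using hd) h1.le
      rw [abs_of_pos h1, cos_zero, mul_one] at h2
      convert h2 using 2
      simp only [hu]
      congr 1
      push_cast
      ring)
  have htail := norm_tsum_sub_sum_Icc_le hsum hM0 hN0 hA hB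
  set T := exp (-(D / L)) with hT
  have hT0 : 0 < T := exp_pos _
  rw [hDh, ← hT] at htrap
  have hconst : 2 * (lineConst K μ ν 0 * (exp (π * ν / 4) * T)) =
      2 ^ (ν + 1) * K / μ * exp (π * ν / 4) * T := by
    rw [lineConst, sin_zero, mul_zero, cos_zero, one_rpow, rpow_add two_pos, rpow_one]
    ring
  have htail' : ‖(h : ℂ) * ∑' k, u k - deQuadrature f h M N‖ ≤
      2 ^ (ν + 1) * K / μ * exp (π * ν / 4) * T := by
    rw [deQuadrature_eq, ← mul_sub, norm_mul, Complex.norm_real, norm_of_nonneg hh0.le, ← hconst]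
    calc h * _ ≤ h * _ := mul_le_mul_of_nonneg_left htail hh0.le
      _ = _ := by field_simp; ring
  -- This makes the factor 1/(1 - T) independent of n: D = (πμ/4)q and q / log q ≥ e.
  have hTle : T ≤ exp (-(π * μ * exp 1 / 4)) := by
    apply exp_le_exp.2
    rw [neg_le_neg_iff, le_div_iff₀ hL0]
    have h1 := exp_one_mul_log_le hq0
    have h2 : D = π * μ / 4 * q := by rw [hq, hD]; field_simp; ring
    rw [h2]
    calc π * μ * exp 1 / 4 * L = π * μ / 4 * (exp 1 * L) := by ring
      _ ≤ _ := by gcongr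
  have hE1 : exp (-(π * μ * exp 1 / 4)) < 1 := by
    rw [exp_lt_one_iff, neg_lt_zero]
    positivity
  have hdabs : |d| < π / 2 := by rwa [abs_of_pos hd]
  have hline := lineConst_pos (ν := ν) hK hμ0 hdabs
  have hcos := cos_half_pi_sin_pos hdabs
  have hcosd := cos_pos_of_abs_lt hdabs
  have htrap' : ‖(∫ t : ℝ, f t) - h * ∑' k, u k‖ ≤
      2 ^ (ν + 1) * K / μ * (2 / ((1 - exp (-(π * μ * exp 1 / 4)))
          * cos (π / 2 * sin d) ^ ν * cos d)) * T := by
    refine htrap.trans ?_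
    have h1 : 0 < 1 - exp (-(π * μ * exp 1 / 4)) := by linarith
    calc 2 * (2 * lineConst K μ ν d) * (T / (1 - T))
        ≤ 2 * (2 * lineConst K μ ν d) * (T / (1 - exp (-(π * μ * exp 1 / 4)))) := by gcongr
      _ = _ := by
        rw [lineConst, rpow_add two_pos, rpow_one]
        field_simp
  calc ‖(∫ t : ℝ, f t) - deQuadrature f h M N‖
      = ‖((∫ t : ℝ, f t) - h * ∑' k, u k) + (h * ∑' k, u k - deQuadrature f h M N)‖ := by
        rw [sub_add_sub_cancel]
    _ ≤ _ := norm_add_le _ _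
    _ ≤ _ := add_le_add htrap' htail'
    _ = _ := by
        rw [C₁, neg_div]
        ring
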